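/- Let $P_x$ be the law of simple random walk $(X_k)_{k\ge 0}$ on $\mathbb{Z}^3$ started at $x$, let $g(x,x')=\sum_{k\ge 0}P_x[X_k=x']$ be its Green function, and for $f:\mathbb{Z}^3\to\mathbb{R}$ with finite support let $Gf(x)=\sum_{x'\in\mathbb{Z}^3}g(x,x')f(x')$. For finitely supported $V$ on $\mathbb{Z}^3$, let $GV$ denote the operator $f\mapsto G(Vf)$ on bounded functions, and let $(f,h)=\sum_{x\in\mathbb{Z}^3}f(x)h(x)$ whenever $f$ or $h$ has finite support. For an integer $N>1$ let $J_0=\{(0,0)\}\times\{1,\dots,N\}\subset\mathbb{Z}^3$ be the vertical rod of length $N$ at the origin of $\mathbb{Z}^2$, and for $\alpha>0$ and $n\ge 1$ set $$u_N=\alpha\,\frac{\log N}{N},\qquad \widetilde V_N=\frac{1}{\log N}\,1_{J_0},\qquad \widetilde a_N(n)=u_N\,\bigl(\widetilde V_N,(G\widetilde V_N)^{n-1}1\bigr),$$ where $1$ is the constant function. **Theorem 4.8.** There is a constant $c_7\in(0,\infty)$, not depending on $\alpha$, $n$ or $N$, such that for all $\alpha>0$ $$0\le \widetilde a_N(n)\le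 \alpha\,c_7^{\,n}\qquad\text{for all integers } n\ge 1,\ N>1.$$ Moreover, for all $\alpha>0$ and every integer $n\ge 1$, $$\lim_{N\to\infty}\widetilde a_N(n)=\alpha\Bigl(\frac{3}{\pi}\Bigr)^{n-1}.$$ -/

import Mathlib

noncomputable section

namespace LongRods

/-- The lattice `ℤ³`. -/
abbrev Site : Type := Fin 3 → ℤ

/-- One step of simple random walk on `ℤ³`: uniform on the six unit vectors `±e_i`. -/
def stepPMF : PMF Site :=
  (PMF.uniformOfFintype (Fin 3 × ℤˣ)).map (fun s => Pi.single s.1 (s.2 : ℤ))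

/-- `P_x`: the law, on the space of `ℤ³`-valued trajectories, of simple random walk started
at `x`, that is, of `X_n = x + ξ_0 + ⋯ + ξ_{n-1}` with i.i.d. steps `ξ_i` of law `stepPMF`. -/
def walkLaw (x : Site) : MeasureTheory.Measure (ℕ → Site) :=
  (MeasureTheory.Measure.infinitePi (fun _ : ℕ => stepPMF.toMeasure)).map
    (fun ξ n => x + ∑ i ∈ Finset.range n, ξ i)

/-- The Green function `g(x, x') = ∑_{n ≥ 0} P_x[X_n = x']` of simple random walk on `ℤ³`. -/
def green (x x' : Site) : ℝ :=
  ∑' n : ℕ, (walkLaw x).real {X : ℕ → Site | X n = x'}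

/-- The operator `G f (x) = ∑_{x'} g(x, x') f(x')`; below it is only applied to functions
with finite support. -/
def greenOp (f : Site → ℝ) (x : Site) : ℝ :=
  ∑' x' : Site, green x x' * f x'

/-- The operator `GV`: multiplication by `V`, followed by `G`. -/
def greenMul (V : Site → ℝ) (f : Site → ℝ) : Site → ℝ :=
  greenOp (V * f)

/-- The scalar product `(f, h) = ∑_x f(x) h(x)`. -/
def scalar (f h : Site → ℝ) : ℝ :=
  ∑' x : Site, f x * h x

/-- The vertical rod `J_y = {y} × {1, …, N}` in `ℤ³`, for `y ∈ ℤ²`. -/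
def rod (y : Fin 2 → ℤ) (N : ℕ) : Set Site :=
  {x | x 0 = y 0 ∧ x 1 = y 1 ∧ 1 ≤ x 2 ∧ x 2 ≤ (N : ℤ)}

/-- The level `u_N = α log N / N`. -/
def level (α : ℝ) (N : ℕ) : ℝ :=
  α * Real.log N / N

/-- The potential `Ṽ_N = 1_{J_0} / log N`. -/
def rodPotential (N : ℕ) : Site → ℝ :=
  (rod 0 N).indicator (fun _ => 1 / Real.log N)

/-- The coefficient `ã_N(n) = u_N (Ṽ_N, (G Ṽ_N)^{n-1} 1)`, for `n ≥ 1`. -/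
def rodCoeff (α : ℝ) (N n : ℕ) : ℝ :=
  level α N * scalar (rodPotential N) ((greenMul (rodPotential N))^[n - 1] 1)

end LongRods

end

/-! ### Simple random walk on ℤ: return probabilities, local bound, Chebyshev's inequality. -/

noncomputable section

namespace LongRods

/-! The key fact is that the Green function summed over a vertical segment of half-length `m` around
its pole is asymptotic to `(3/π) log m` (`tendsto_segmentGreen_div_log`). Organise the walk by its
number `j` of horizontal steps. A visit to the axis requires the planar walk to be at its origin,
which forces `j = 2 i`; in rotated coordinates the planar walk is a pair of independent walks on ℤ,
so this has probability `lineProb (2 * i) 0 ^ 2`, which is `~ 1/(π i)` by Wallis' product. The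
expected time spent at a given `j` is 3/2. While `i ≤ m²` the vertical coordinate mostly stays
inside the segment (Chebyshev), and the part with `i > m²` is bounded because each site contributes
`O(i^{-3/2})`. Hence the sum is `(3/2)(1/π) log m² + O(1)`.

On the rod, `G Ṽ_N` is a nonnegative matrix whose row and column sums are at most `rodNorm N → 3/π`.
This gives `rodMean N m ≤ rodNorm N ^ m`, and with it the uniform bound. For the lower bound, the
average column sum also tends to 3/π (a Cesàro mean of the segment asymptotics,
`tendsto_sum_segmentGreen_div`), so the columns fall short of `rodNorm N` by `o(1)` on average.
Since the iterates are uniformly bounded, each application of the matrix multiplies the mean by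
`3/π` up to `o(1)` (`le_rodMean_succ`). -/

/-- The transition probability `P[S_n = k]` of simple random walk on `ℤ` started at `0`. -/
def lineProb : ℕ → ℤ → ℝ
  | 0, k => if k = 0 then 1 else 0
  | n + 1, k => (lineProb n (k - 1) + lineProb n (k + 1)) / 2

theorem lineProb_succ (n : ℕ) (k : ℤ) :
    lineProb (n + 1) k = (lineProb n (k - 1) + lineProb n (k + 1)) / 2 := rfl

theorem lineProb_nonneg (n : ℕ) (k : ℤ) : 0 ≤ lineProb n k := by
  induction n generalizing k with
  | zero => unfold lineProb; split_ifs <;> norm_num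
  | succ n ih => rw [lineProb_succ]; linarith [ih (k - 1), ih (k + 1)]

theorem lineProb_eq_zero_of_lt {n : ℕ} {k : ℤ} (h : (n : ℤ) < |k|) : lineProb n k = 0 := by
  induction n generalizing k with
  | zero =>
    have : k ≠ 0 := by rintro rfl; simp at h
    simp [lineProb, this]
  | succ n ih =>
    push_cast at h
    rw [lineProb_succ, ih (by grind), ih (by grind)]
    simp

theorem lineProb_eq_zero_of_odd {n : ℕ} {k : ℤ} (h : Odd ((n : ℤ) + k)) : lineProb n k = 0 := by
  induction n generalizing k with
  | zero =>
    have : k ≠ 0 := by rintro rfl; simp at h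
    simp [lineProb, this]
  | succ n ih =>
    push_cast at h
    rw [lineProb_succ, ih (by grind), ih (by grind)]
    simp

theorem lineProb_eq_choose (n i : ℕ) : lineProb n (2 * i - n) = n.choose i / 2 ^ n := by
  induction n generalizing i with
  | zero => rcases i with _ | i <;> simp [lineProb]; omega
  | succ n ih =>
    rw [lineProb_succ]
    have h2 : (2 * (i : ℤ) - ((n + 1 : ℕ) : ℤ) + 1) = 2 * i - n := by push_cast; ring
    rw [h2, ih]
    rcases i with _ | i
    · rw [lineProb_eq_zero_of_lt (by push_cast; grind)]
      simp [pow_succ]; ring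
    · have h1 : (2 * ((i + 1 : ℕ) : ℤ) - ((n + 1 : ℕ) : ℤ) - 1) = 2 * i - n := by push_cast; ring
      rw [h1, ih, Nat.choose_succ_succ, pow_succ]
      push_cast
      ring

theorem lineProb_two_mul_zero (n : ℕ) : lineProb (2 * n) 0 = n.centralBinom / 4 ^ n := by
  have := lineProb_eq_choose (2 * n) n
  rw [pow_mul] at this
  norm_num at this
  rw [this, Nat.centralBinom]

theorem lineProb_two_mul_zero_succ (n : ℕ) :
    lineProb (2 * (n + 1)) 0 = lineProb (2 * n) 0 * ((2 * n + 1) / (2 * n + 2)) := by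
  rw [lineProb_two_mul_zero, lineProb_two_mul_zero]
  have h : ((n : ℝ) + 1) * (n + 1).centralBinom = 2 * (2 * n + 1) * n.centralBinom := by
    exact_mod_cast Nat.succ_mul_centralBinom_succ n
  field_simp
  rw [pow_succ]
  linear_combination 2 * 4 ^ n * h

/-- The one-step ratios of the three factors cancel exactly. This is the source of `π` in the limit.
-/
theorem lineProb_two_mul_zero_sq_mul_wallis (n : ℕ) :
    lineProb (2 * n) 0 ^ 2 * (2 * n + 1) * Real.Wallis.W n = 1 := by
  induction n with
  | zero => simp [lineProb, Real.Wallis.W]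
  | succ n ih =>
    rw [lineProb_two_mul_zero_succ, Real.Wallis.W_succ]
    refine Eq.trans ?_ ih
    push_cast
    field_simp
    ring

theorem lineProb_two_mul_zero_sq_le (n : ℕ) : lineProb (2 * n) 0 ^ 2 ≤ 1 / (2 * n + 1) := by
  induction n with
  | zero => simp [lineProb]
  | succ n ih =>
    rw [lineProb_two_mul_zero_succ, mul_pow]
    calc _ ≤ 1 / (2 * (n : ℝ) + 1) * ((2 * n + 1) / (2 * n + 2)) ^ 2 := by gcongr
      _ ≤ _ := by
        push_cast
        rw [div_pow, div_mul_div_comm, div_le_div_iff₀ (by positivity) (by positivity)]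
        have : (0 : ℝ) ≤ n := by positivity
        nlinarith [mul_nonneg this this]

theorem lineProb_two_mul_le (n : ℕ) (k : ℤ) : lineProb (2 * n) k ≤ lineProb (2 * n) 0 := by
  by_cases hk : (2 * n : ℤ) < |k|
  · rw [lineProb_eq_zero_of_lt (by exact_mod_cast hk)]
    exact lineProb_nonneg _ _
  rcases Int.even_or_odd k with h | h
  · obtain ⟨a, rfl⟩ := h
    obtain ⟨i, hi⟩ := Int.eq_ofNat_of_zero_le (a := n + a) (by grind)
    have e : (a + a : ℤ) = 2 * i - (2 * n : ℕ) := by push_cast; linarith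
    rw [e, lineProb_eq_choose, lineProb_two_mul_zero, pow_mul]
    norm_num
    gcongr
    exact Nat.choose_le_centralBinom i n
  · rw [lineProb_eq_zero_of_odd (by push_cast; grind)]
    exact lineProb_nonneg _ _

theorem lineProb_sq_le (n : ℕ) (k : ℤ) : lineProb n k ^ 2 ≤ 2 / (n + 1) := by
  rcases Nat.even_or_odd' n with ⟨m, rfl | rfl⟩
  · have h := lineProb_two_mul_le m k
    have h0 := lineProb_nonneg (2 * m) k
    calc _ ≤ lineProb (2 * m) 0 ^ 2 := by gcongr
      _ ≤ 1 / (2 * m + 1) := lineProb_two_mul_zero_sq_le m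
      _ ≤ _ := by push_cast; gcongr; norm_num
  · have h : lineProb (2 * m + 1) k ≤ lineProb (2 * m) 0 := by
      rw [lineProb_succ]
      linarith [lineProb_two_mul_le m (k - 1), lineProb_two_mul_le m (k + 1)]
    have h0 := lineProb_nonneg (2 * m + 1) k
    calc _ ≤ lineProb (2 * m) 0 ^ 2 := by gcongr
      _ ≤ 1 / (2 * m + 1) := lineProb_two_mul_zero_sq_le m
      _ ≤ _ := by
        push_cast
        rw [div_le_div_iff₀ (by positivity) (by positivity)]
        linarith

/-- The weighted arithmetic-geometric form of the bound `P[S_n = k] ≤ √2 / √(n + 1)`. -/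
theorem lineProb_le (n : ℕ) (k : ℤ) {t : ℝ} (ht : 0 < t) :
    lineProb n k ≤ t + 1 / (t * (n + 1)) := by
  have h := lineProb_sq_le n k
  have h0 : 0 < t + 1 / (t * (n + 1)) := by positivity
  refine le_of_sq_le_sq ?_ h0.le
  refine h.trans ?_
  have : t * (1 / (t * ((n : ℝ) + 1))) = 1 / (n + 1) := by field_simp
  have e : 2 / ((n : ℝ) + 1) = 2 * (1 / (n + 1)) := by ring
  rw [e, ← this]
  nlinarith [sq_nonneg t, sq_nonneg (1 / (t * ((n : ℝ) + 1)))]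

theorem sum_lineProb_le_one (s : Finset ℤ) (n : ℕ) (x : ℤ) :
    ∑ k ∈ s, lineProb n (k - x) ≤ 1 := by
  induction n generalizing x with
  | zero =>
    simp only [lineProb, sub_eq_zero, Finset.sum_ite_eq']
    split_ifs <;> norm_num
  | succ n ih =>
    have e : ∑ k ∈ s, lineProb (n + 1) (k - x) =
        (∑ k ∈ s, lineProb n (k - (x + 1)) + ∑ k ∈ s, lineProb n (k - (x - 1))) / 2 := by
      rw [← Finset.sum_add_distrib, Finset.sum_div]
      refine Finset.sum_congr rfl fun k _ => ?_
      rw [lineProb_succ]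
      ring_nf
    rw [e]
    linarith [ih (x + 1), ih (x - 1)]

/-- Chebyshev with the second moment `x² + n` of the walk started at `x`. The general starting point
lets one condition on the first step: the mean of `(x ± 1)² + n` is `x² + n + 1`. -/
theorem le_sum_lineProb_shift (m n : ℕ) (x : ℤ) :
    1 - (x ^ 2 + n) / (m + 1 : ℝ) ^ 2 ≤ ∑ k ∈ Finset.Icc (-m : ℤ) m, lineProb n (k - x) := by
  induction n generalizing x with
  | zero =>
    simp only [lineProb, sub_eq_zero, Finset.sum_ite_eq', Finset.mem_Icc]
    split_ifs with h
    · have : (0 : ℝ) ≤ (x ^ 2 + (0 : ℕ)) / (m + 1 : ℝ) ^ 2 := by positivity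
      linarith
    · have h1 : (m + 1 : ℤ) ≤ |x| := by grind
      have h2 : (m + 1 : ℝ) ≤ |(x : ℝ)| := by exact_mod_cast h1
      have h3 : 1 ≤ (x ^ 2 + (0 : ℕ)) / (m + 1 : ℝ) ^ 2 := by
        rw [one_le_div (by positivity), ← sq_abs (x : ℝ)]
        push_cast
        nlinarith
      linarith
  | succ n ih =>
    have e : ∑ k ∈ Finset.Icc (-m : ℤ) m, lineProb (n + 1) (k - x) =
        (∑ k ∈ Finset.Icc (-m : ℤ) m, lineProb n (k - (x + 1)) +
          ∑ k ∈ Finset.Icc (-m : ℤ) m, lineProb n (k - (x - 1))) / 2 := by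
      rw [← Finset.sum_add_distrib, Finset.sum_div]
      refine Finset.sum_congr rfl fun k _ => ?_
      rw [lineProb_succ]
      ring_nf
    rw [e]
    have h1 := ih (x + 1)
    have h2 := ih (x - 1)
    push_cast at h1 h2 ⊢
    have : ((x : ℝ) ^ 2 + (n + 1)) / (m + 1 : ℝ) ^ 2 = ((((x : ℝ) + 1) ^ 2 + n) / (m + 1 : ℝ) ^ 2 +
      (((x : ℝ) - 1) ^ 2 + n) / (m + 1 : ℝ) ^ 2) / 2 := by ring
    linarith

/-- Chebyshev's inequality for simple random walk on `ℤ`. -/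
theorem le_sum_lineProb (m n : ℕ) :
    1 - n / (m + 1 : ℝ) ^ 2 ≤ ∑ k ∈ Finset.Icc (-m : ℤ) m, lineProb n k := by
  simpa using le_sum_lineProb_shift m n 0

end LongRods

end

/-! ### Explicit transition probabilities of the walk on ℤ³. -/

noncomputable section

namespace LongRods

open MeasureTheory ProbabilityTheory

/-- The transition probability `P_0[X_n = x]`, split according to the numbers of horizontal and of
vertical steps; the horizontal walk is a product of two walks on `ℤ` in rotated coordinates. -/
def latticeProb (n : ℕ) (x : Site) : ℝ :=
  ∑ p ∈ Finset.HasAntidiagonal.antidiagonal n, (n.choose p.1 : ℝ) * ((2 / 3) ^ p.1 * (1 / 3) ^ p.2 *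
    (lineProb p.1 (x 0 + x 1) * lineProb p.1 (x 0 - x 1) * lineProb p.2 (x 2)))

theorem latticeProb_nonneg (n : ℕ) (x : Site) : 0 ≤ latticeProb n x :=
  Finset.sum_nonneg fun p _ => by
    have h1 := lineProb_nonneg p.1 (x 0 + x 1)
    have h2 := lineProb_nonneg p.1 (x 0 - x 1)
    have h3 := lineProb_nonneg p.2 (x 2)
    positivity

theorem latticeProb_zero (x : Site) : latticeProb 0 x = if x = 0 then 1 else 0 := by
  simp only [latticeProb, Finset.HasAntidiagonal.antidiagonal_zero, Finset.sum_singleton, lineProb]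
  split_ifs with h1 h2 h3 h4 h4 h4 h4 <;> simp_all
  · exact h4 (by ext i; fin_cases i <;> simp <;> omega)

/-- Pascal's rule separates a horizontal step from a vertical one. The four horizontal unit vectors
realise the four sign choices for the increments of `x 0 + x 1` and `x 0 - x 1`, so these two
coordinates move independently. -/
theorem latticeProb_succ (n : ℕ) (x : Site) :
    latticeProb (n + 1) x =
      ∑ s : Fin 3 × ℤˣ, 1 / 6 * latticeProb n (x - Pi.single s.1 (s.2 : ℤ)) := by
  have hu : (Finset.univ : Finset ℤˣ) = {1, -1} := rfl
  rw [latticeProb, Finset.sum_antidiagonal_choose_succ_mul (fun i j => (2 / 3 : ℝ) ^ i *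
    (1 / 3) ^ j * (lineProb i (x 0 + x 1) * lineProb i (x 0 - x 1) * lineProb j (x 2))),
    Fintype.sum_prod_type]
  simp only [latticeProb, Finset.mul_sum, Fin.sum_univ_three, hu]
  rw [← Finset.sum_add_distrib]
  simp only [Finset.sum_pair (show (1 : ℤˣ) ≠ -1 by decide), ← Finset.sum_add_distrib]
  refine Finset.sum_congr rfl fun p hp => ?_
  -- One of the two sums from Pascal's rule carries `n.choose p.2`.
  have hc : n.choose p.2 = n.choose p.1 := by
    rw [Finset.HasAntidiagonal.mem_antidiagonal] at hp
    exact Nat.choose_symm_of_eq_add (by omega)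
  rw [hc]
  simp [lineProb_succ, pow_succ]
  have e1 : x 0 - 1 + x 1 = x 0 + x 1 - 1 := by ring
  have e2 : x 0 - 1 - x 1 = x 0 - x 1 - 1 := by ring
  have e3 : x 0 + 1 + x 1 = x 0 + x 1 + 1 := by ring
  have e4 : x 0 + 1 - x 1 = x 0 - x 1 + 1 := by ring
  have e5 : x 0 + (x 1 - 1) = x 0 + x 1 - 1 := by ring
  have e6 : x 0 - (x 1 - 1) = x 0 - x 1 + 1 := by ring
  have e7 : x 0 + (x 1 + 1) = x 0 + x 1 + 1 := by ring
  have e8 : x 0 - (x 1 + 1) = x 0 - x 1 - 1 := by ring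
  rw [e1, e2, e3, e4, e5, e6, e7, e8]
  ring

theorem lintegral_stepPMF (f : Site → ENNReal) :
    ∫⁻ e, f e ∂stepPMF.toMeasure =
      ∑ s : Fin 3 × ℤˣ, ENNReal.ofReal (1 / 6) * f (Pi.single s.1 (s.2 : ℤ)) := by
  let _ : MeasurableSpace (Fin 3 × ℤˣ) := ⊤
  have hm : Measurable fun s : Fin 3 × ℤˣ => (Pi.single s.1 (s.2 : ℤ) : Site) :=
    measurable_from_top
  rw [stepPMF, ← PMF.toMeasure_map (hf := hm), lintegral_map (measurable_of_countable f) hm,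
    lintegral_fintype]
  refine Finset.sum_congr rfl fun s _ => ?_
  rw [PMF.toMeasure_apply_singleton _ _ (MeasurableSet.singleton s), PMF.uniformOfFintype_apply,
    mul_comm]
  congr 1
  rw [ENNReal.ofReal_div_of_pos (by norm_num)]
  simp

theorem infinitePi_sum_range_eq (n : ℕ) (x : Site) :
    Measure.infinitePi (fun _ : ℕ => stepPMF.toMeasure) {ξ | ∑ i ∈ Finset.range n, ξ i = x} =
      ENNReal.ofReal (latticeProb n x) := by
  induction n generalizing x with
  | zero =>
    by_cases h : x = 0
    · simp [latticeProb_zero, h]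
    · simp [latticeProb_zero, h, Ne.symm h]
  | succ n ih =>
    set μ := Measure.infinitePi (fun _ : ℕ => stepPMF.toMeasure)
    have hmeas : ∀ i : ℕ, Measurable fun ξ : ℕ → Site => ξ i := fun i => measurable_pi_apply i
    have hind : iIndepFun (fun (i : ℕ) (ξ : ℕ → Site) => ξ i) μ :=
      iIndepFun_infinitePi (X := fun _ => id) (fun _ => measurable_id)
    have hmS : Measurable (∑ j ∈ Finset.range n, fun ξ : ℕ → Site => ξ j) := by
      rw [Finset.sum_fn]
      exact Finset.measurable_sum _ fun i _ => hmeas i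
    have hconv := (hind.indepFun_sum_range_succ hmeas n).map_add_eq_map_conv_map hmS (hmeas n)
    have hlast : μ.map (fun ξ : ℕ → Site => ξ n) = stepPMF.toMeasure :=
      Measure.infinitePi_map_eval (fun _ : ℕ => stepPMF.toMeasure) n
    -- Commuting the convolution puts the single step in the outer integral, where it becomes a sum
    -- of six terms.
    rw [hlast, Measure.conv_comm] at hconv
    have hset : {ξ : ℕ → Site | ∑ i ∈ Finset.range (n + 1), ξ i = x} =
        ((∑ j ∈ Finset.range n, fun ξ : ℕ → Site => ξ j) + fun ξ => ξ n) ⁻¹' {x} := by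
      ext ξ
      simp [Finset.sum_range_succ]
    rw [hset, ← Measure.map_apply (hmS.add (hmeas n)) (MeasurableSet.singleton x), hconv,
      ← lintegral_indicator_one (MeasurableSet.singleton x),
      Measure.lintegral_conv (measurable_of_countable _), lintegral_stepPMF, latticeProb_succ,
      ENNReal.ofReal_sum_of_nonneg (fun s _ => mul_nonneg (by norm_num) (latticeProb_nonneg _ _))]
    refine Finset.sum_congr rfl fun s _ => ?_
    rw [ENNReal.ofReal_mul (by norm_num), ← ih]
    congr 1
    set e : Site := Pi.single s.1 (s.2 : ℤ)
    have hind1 : ∀ y : Site, ({x} : Set Site).indicator (1 : Site → ENNReal) (e + y) =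
        ({x - e} : Set Site).indicator 1 y := by
      intro y
      simp only [Set.indicator, Set.mem_singleton_iff, eq_sub_iff_add_eq, add_comm e y,
        Pi.one_apply]
    simp_rw [hind1]
    rw [lintegral_indicator_one (MeasurableSet.singleton _),
      Measure.map_apply hmS (MeasurableSet.singleton _)]
    congr 1
    ext ξ
    simp

theorem walkLaw_real_eq (n : ℕ) (x y : Site) :
    (walkLaw x).real {X : ℕ → Site | X n = y} = latticeProb n (y - x) := by
  have hm : Measurable fun (ξ : ℕ → Site) (n : ℕ) => x + ∑ i ∈ Finset.range n, ξ i :=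
    measurable_pi_lambda _ fun n =>
      (Finset.measurable_sum _ fun i _ => measurable_pi_apply i).const_add x
  have hs : MeasurableSet {X : ℕ → Site | X n = y} :=
    (measurable_pi_apply n : Measurable fun X : ℕ → Site => X n) (MeasurableSet.singleton y)
  rw [measureReal_def, walkLaw, Measure.map_apply hm hs]
  have : (fun (ξ : ℕ → Site) (n : ℕ) => x + ∑ i ∈ Finset.range n, ξ i) ⁻¹'
      {X : ℕ → Site | X n = y} = {ξ | ∑ i ∈ Finset.range n, ξ i = y - x} := by
    ext ξ
    simp [eq_sub_iff_add_eq']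
  rw [this, infinitePi_sum_range_eq, ENNReal.toReal_ofReal (latticeProb_nonneg _ _)]

theorem green_eq_tsum (x y : Site) : green x y = ∑' n, latticeProb n (y - x) := by
  simp only [green, walkLaw_real_eq]

end LongRods

end

/-! ### The Green function on the vertical axis and its sums over segments. -/

noncomputable section

namespace LongRods

/-- The probability that the first `j + l` steps of the walk contain exactly `j` horizontal ones. -/
def stepWeight (j l : ℕ) : ℝ := ((j + l).choose j : ℝ) * ((2 / 3) ^ j * (1 / 3) ^ l)

theorem stepWeight_nonneg (j l : ℕ) : 0 ≤ stepWeight j l := by unfold stepWeight; positivity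

/-- Negative binomial series: the time spent with exactly `j` horizontal steps is geometric with
success probability 2/3. -/
theorem hasSum_stepWeight (j : ℕ) : HasSum (stepWeight j) (3 / 2) := by
  have h := (hasSum_choose_mul_geometric_of_norm_lt_one j
    (show ‖(1 / 3 : ℝ)‖ < 1 by norm_num)).mul_left ((2 / 3 : ℝ) ^ j)
  have hf : stepWeight j = fun l => (2 / 3) ^ j * (((l + j).choose j : ℝ) * (1 / 3) ^ l) := by
    ext l
    rw [stepWeight, add_comm j l]
    ring
  have hv : (3 / 2 : ℝ) = (2 / 3) ^ j * (1 / (1 - 1 / 3) ^ (j + 1)) := by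
    rw [show (1 - 1 / 3 : ℝ) = 2 / 3 by norm_num, pow_succ]
    field_simp
  rw [hf, hv]
  exact h

/-- Trades a factor in `l` for one in `j`, which gives both the first moment in `l` and the bound on
the mean of `1 / (l + 1)`. -/
theorem stepWeight_succ_mul (j l : ℕ) :
    stepWeight j (l + 1) * (l + 1) = (j + 1) / 2 * stepWeight (j + 1) l := by
  have h : ((j + l + 1).choose (j + 1) : ℝ) * (j + 1) = (j + l + 1).choose j * (l + 1) := by
    have := Nat.choose_succ_right_eq (j + l + 1) j
    rw [show j + l + 1 - j = l + 1 by omega] at this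
    exact_mod_cast this
  unfold stepWeight
  rw [show j + 1 + l = j + l + 1 by ring, ← add_assoc, pow_succ, pow_succ]
  linear_combination -(2 / 3) ^ j * (1 / 3) ^ l * (1 / 3) * h

theorem hasSum_stepWeight_mul (j : ℕ) :
    HasSum (fun l : ℕ => stepWeight j l * l) (3 / 4 * (j + 1)) := by
  rw [← hasSum_nat_add_iff' 1]
  have h := (hasSum_stepWeight (j + 1)).mul_left (((j : ℝ) + 1) / 2)
  have hv : 3 / 4 * ((j : ℝ) + 1) - ∑ i ∈ Finset.range 1, stepWeight j i * (i : ℝ) =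
      (j + 1) / 2 * (3 / 2) := by
    simp
    ring
  have hf : (fun l : ℕ => stepWeight j (l + 1) * ((l + 1 : ℕ) : ℝ)) =
      fun l => (j + 1) / 2 * stepWeight (j + 1) l := by
    ext l
    rw [← stepWeight_succ_mul]
    push_cast
    rfl
  rw [hv, hf]
  exact h

theorem stepWeight_div_le (j : ℕ) :
    Summable (fun l : ℕ => stepWeight j l * (1 / (l + 1))) ∧
      ∑' l : ℕ, stepWeight j l * (1 / (l + 1)) ≤ 6 / (j + 1) := by
  have hle : ∀ l : ℕ, stepWeight j l * (1 / (l + 1)) ≤ stepWeight j l := fun l =>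
    mul_le_of_le_one_right (stepWeight_nonneg j l)
      (by rw [div_le_one (by positivity)]; linarith [l.cast_nonneg (α := ℝ)])
  have hs : Summable (fun l : ℕ => stepWeight j l * (1 / (l + 1))) :=
    Summable.of_nonneg_of_le (fun l => mul_nonneg (stepWeight_nonneg j l) (by positivity)) hle
      (hasSum_stepWeight j).summable
  refine ⟨hs, ?_⟩
  rcases j with _ | j
  · refine (hs.tsum_le_tsum hle (hasSum_stepWeight 0).summable).trans ?_
    rw [(hasSum_stepWeight 0).tsum_eq]
    norm_num
  · have e : ∀ l : ℕ, stepWeight (j + 1) l * (1 / (l + 1)) =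
        2 / (j + 1) * stepWeight j (l + 1) := by
      intro l
      have := stepWeight_succ_mul j l
      field_simp
      linarith
    have h1 := (hasSum_stepWeight j).summable
    have h2 := h1.sum_add_tsum_nat_add 1
    rw [(hasSum_stepWeight j).tsum_eq] at h2
    have h3 : 0 ≤ ∑ l ∈ Finset.range 1, stepWeight j l :=
      Finset.sum_nonneg fun l _ => stepWeight_nonneg j l
    simp_rw [e]
    rw [tsum_mul_left]
    calc _ ≤ 2 / ((j : ℝ) + 1) * (3 / 2) := by gcongr; linarith
      _ ≤ _ := by
        push_cast
        rw [div_mul_eq_mul_div, div_le_div_iff₀ (by positivity) (by positivity)]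
        linarith [j.cast_nonneg (α := ℝ)]

/-- The expected number of visits of the vertical component to height `k` at those times at which
exactly `j` horizontal steps have been made. -/
def visits (j : ℕ) (k : ℤ) : ℝ := ∑' l, stepWeight j l * lineProb l k

theorem lineProb_le_one (n : ℕ) (k : ℤ) : lineProb n k ≤ 1 := by
  simpa using sum_lineProb_le_one {k} n 0

theorem summable_visits (j : ℕ) (k : ℤ) : Summable fun l => stepWeight j l * lineProb l k :=
  Summable.of_nonneg_of_le (fun l => mul_nonneg (stepWeight_nonneg j l) (lineProb_nonneg l k))
    (fun l => mul_le_of_le_one_right (stepWeight_nonneg j l) (lineProb_le_one l k))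
    (hasSum_stepWeight j).summable

theorem visits_nonneg (j : ℕ) (k : ℤ) : 0 ≤ visits j k :=
  tsum_nonneg fun l => mul_nonneg (stepWeight_nonneg j l) (lineProb_nonneg l k)

theorem visits_le (j : ℕ) (k : ℤ) : visits j k ≤ 8 / √(j + 1) := by
  have hs : 0 < √((j : ℝ) + 1) := by positivity
  -- This `t` balances the two terms of `lineProb_le`, which after summation are of order `t` and `1
  -- / (t * (j + 1))`.
  set t : ℝ := 1 / √(j + 1)
  have ht : 0 < t := by positivity
  obtain ⟨h1, h2⟩ := stepWeight_div_le j
  have hw := hasSum_stepWeight j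
  have hle : ∀ l : ℕ, stepWeight j l * lineProb l k ≤
      t * stepWeight j l + 1 / t * (stepWeight j l * (1 / (l + 1))) := by
    intro l
    refine (mul_le_mul_of_nonneg_left (lineProb_le l k ht) (stepWeight_nonneg j l)).trans_eq ?_
    field_simp
  calc visits j k ≤ ∑' l : ℕ, (t * stepWeight j l + 1 / t * (stepWeight j l * (1 / (l + 1)))) :=
        (summable_visits j k).tsum_le_tsum hle ((hw.summable.mul_left t).add (h1.mul_left _))
    _ = t * (3 / 2) + 1 / t * ∑' l : ℕ, stepWeight j l * (1 / (l + 1)) := by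
        rw [(hw.summable.mul_left t).tsum_add (h1.mul_left _), tsum_mul_left, tsum_mul_left,
          hw.tsum_eq]
    _ ≤ t * (3 / 2) + 1 / t * (6 / (j + 1)) := by gcongr
    _ = (15 / 2) / √(j + 1) := by
        have : 6 / ((j : ℝ) + 1) = 6 / √((j : ℝ) + 1) ^ 2 := by rw [Real.sq_sqrt (by positivity)]
        rw [this]
        simp only [t]
        field_simp
        norm_num
    _ ≤ _ := by gcongr; norm_num

theorem sum_visits (s : Finset ℤ) (j : ℕ) :
    ∑ k ∈ s, visits j k = ∑' l, stepWeight j l * ∑ k ∈ s, lineProb l k := by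
  simp only [visits, Finset.mul_sum]
  exact (Summable.tsum_finsetSum fun k _ => summable_visits j k).symm

theorem summable_sum_visits (s : Finset ℤ) (j : ℕ) :
    Summable fun l => stepWeight j l * ∑ k ∈ s, lineProb l k := by
  simp only [Finset.mul_sum]
  exact summable_sum fun k _ => summable_visits j k

theorem sum_visits_le (s : Finset ℤ) (j : ℕ) : ∑ k ∈ s, visits j k ≤ 3 / 2 := by
  rw [sum_visits, ← (hasSum_stepWeight j).tsum_eq]
  refine (summable_sum_visits s j).tsum_le_tsum (fun l => ?_) (hasSum_stepWeight j).summable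
  exact mul_le_of_le_one_right (stepWeight_nonneg j l) (by simpa using sum_lineProb_le_one s l 0)

theorem le_sum_visits (m j : ℕ) :
    3 / 2 - 3 / 4 * (j + 1) / (m + 1 : ℝ) ^ 2 ≤ ∑ k ∈ Finset.Icc (-m : ℤ) m, visits j k := by
  have h := (hasSum_stepWeight j).sub ((hasSum_stepWeight_mul j).div_const ((m + 1 : ℝ) ^ 2))
  rw [sum_visits, ← h.tsum_eq]
  refine h.summable.tsum_le_tsum (fun l => ?_) (summable_sum_visits _ j)
  calc _ = stepWeight j l * (1 - l / (m + 1 : ℝ) ^ 2) := by ring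
    _ ≤ _ := mul_le_mul_of_nonneg_left (le_sum_lineProb m l) (stepWeight_nonneg j l)

/-- Telescoping majorant for the `-3/2` power. -/
theorem one_div_mul_sqrt_le {x : ℝ} (hx : 0 < x) :
    1 / ((x + 1) * √(x + 1)) ≤ 2 * (1 / √x - 1 / √(x + 1)) := by
  have ha : 0 < √x := by positivity
  have hb : 0 < √(x + 1) := by positivity
  have hab : √x ≤ √(x + 1) := Real.sqrt_le_sqrt (by linarith)
  have h1 : √x ^ 2 = x := Real.sq_sqrt hx.le
  have h2 : √(x + 1) ^ 2 = x + 1 := Real.sq_sqrt (by linarith)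
  set a := √x
  set b := √(x + 1)
  have e : 2 * (1 / a - 1 / b) = 2 / (a * b * (a + b)) := by
    field_simp
    nlinarith
  rw [e, ← h2, div_le_div_iff₀ (by positivity) (by positivity)]
  have : a * b * (a + b) ≤ b * b * (b + b) := by gcongr
  nlinarith

theorem sum_one_div_mul_sqrt_le {M : ℕ} (hM : 0 < M) (n : ℕ) :
    ∑ i ∈ Finset.range n, 1 / (((i + M : ℕ) + 1 : ℝ) * √((i + M : ℕ) + 1)) ≤ 2 / √M := by
  have h : ∑ i ∈ Finset.range n, 1 / (((i + M : ℕ) + 1 : ℝ) * √((i + M : ℕ) + 1)) ≤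
      2 * (1 / √M) - 2 * (1 / √((n + M : ℕ) : ℝ)) := by
    induction n with
    | zero => simp
    | succ n ih =>
      rw [Finset.sum_range_succ]
      have := one_div_mul_sqrt_le (x := ((n + M : ℕ) : ℝ)) (by positivity)
      rw [show ((n + 1 + M : ℕ) : ℝ) = (n + M : ℕ) + 1 by push_cast; ring]
      linarith
  have : 0 ≤ 2 * (1 / √((n + M : ℕ) : ℝ)) := by positivity
  calc _ ≤ _ := h
    _ ≤ 2 * (1 / √M) := by linarith
    _ = _ := by ring

theorem summable_one_div_mul_sqrt :
    Summable fun i : ℕ => 1 / (((i : ℝ) + 1) * √(i + 1)) :=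
  (summable_nat_add_iff 1).1 <| summable_of_sum_range_le (fun i => by positivity)
    fun n => sum_one_div_mul_sqrt_le one_pos n

/-- The Green function `g(0, (0, 0, k))` on the vertical axis. -/
def axisGreen (k : ℤ) : ℝ := ∑' n, latticeProb n ![0, 0, k]

theorem axisGreen_nonneg (k : ℤ) : 0 ≤ axisGreen k := tsum_nonneg fun n => latticeProb_nonneg n _

/-- The return probability to the origin of simple random walk on `ℤ²` at time `2 i`. -/
def planeReturn (i : ℕ) : ℝ := lineProb (2 * i) 0 ^ 2

theorem planeReturn_nonneg (i : ℕ) : 0 ≤ planeReturn i := sq_nonneg _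

theorem planeReturn_mul_visits_le (i : ℕ) (k : ℤ) :
    planeReturn i * visits (2 * i) k ≤ 8 * (1 / (((i : ℝ) + 1) * √(i + 1))) := by
  have hi : (i : ℝ) + 1 ≤ 2 * i + 1 := by linarith [i.cast_nonneg (α := ℝ)]
  calc _ ≤ 1 / ((i : ℝ) + 1) * (8 / √(i + 1)) := by
        refine mul_le_mul ?_ ?_ (visits_nonneg _ _) (by positivity)
        · refine (lineProb_two_mul_zero_sq_le i).trans ?_
          gcongr
        · refine (visits_le _ k).trans ?_
          push_cast
          gcongr
    _ = _ := by field_simp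

theorem summable_planeReturn_mul_visits (k : ℤ) :
    Summable fun i => planeReturn i * visits (2 * i) k :=
  Summable.of_nonneg_of_le (fun i => mul_nonneg (planeReturn_nonneg i) (visits_nonneg _ _))
    (fun i => planeReturn_mul_visits_le i k) (summable_one_div_mul_sqrt.mul_left 8)

/-- Fubini over the pairs (horizontal steps, vertical steps) replaces the sum over time; odd numbers
of horizontal steps drop out by parity. -/
theorem axisGreen_eq_tsum (k : ℤ) :
    axisGreen k = ∑' i, planeReturn i * visits (2 * i) k := by
  set f : ℕ × ℕ → ℝ := fun p => stepWeight p.1 p.2 * (lineProb p.1 0 ^ 2 * lineProb p.2 k)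
  have hf0 : 0 ≤ f := fun p =>
    mul_nonneg (stepWeight_nonneg _ _) (mul_nonneg (sq_nonneg _) (lineProb_nonneg _ _))
  have hrow : ∀ j, ∀ l, f (j, l) = lineProb j 0 ^ 2 * (stepWeight j l * lineProb l k) :=
    fun j l => by simp only [f]; ring
  have htsum : ∀ j, ∑' l, f (j, l) = lineProb j 0 ^ 2 * visits j k := fun j => by
    simp_rw [hrow, tsum_mul_left]
    rfl
  have hinj : Function.Injective fun i : ℕ => 2 * i := fun a b h => by simpa using h
  have hsupp : ∀ j, j ∉ Set.range (fun i : ℕ => 2 * i) → lineProb j 0 ^ 2 * visits j k = 0 := by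
    intro j hj
    rcases Nat.even_or_odd j with ⟨i, hi⟩ | hodd
    · exact absurd ⟨i, by simp only; omega⟩ hj
    · rw [lineProb_eq_zero_of_odd (by simpa using hodd)]
      simp
  have hf : Summable f := by
    rw [summable_prod_of_nonneg hf0]
    refine ⟨fun j => ?_, ?_⟩
    · simp_rw [hrow]
      exact (summable_visits j k).mul_left _
    · simp_rw [htsum]
      exact (hinj.summable_iff hsupp).1 (summable_planeReturn_mul_visits k)
  calc axisGreen k = ∑' n, ∑ p ∈ Finset.HasAntidiagonal.antidiagonal n, f p := by
        refine tsum_congr fun n => Finset.sum_congr rfl fun p hp => ?_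
        rw [Finset.HasAntidiagonal.mem_antidiagonal] at hp
        simp only [f, stepWeight, hp]
        simp
        ring
    _ = ∑' p, f p := by
        rw [← Finset.HasAntidiagonal.sigmaAntidiagonalEquivProd.tsum_eq f]
        have hs := Finset.HasAntidiagonal.sigmaAntidiagonalEquivProd.summable_iff.2 hf
        refine Eq.trans ?_ (hs.tsum_sigma' fun n => (hasSum_fintype _).summable).symm
        refine tsum_congr fun n => ?_
        rw [tsum_fintype, ← Finset.sum_coe_sort]
        rfl
    _ = ∑' j, lineProb j 0 ^ 2 * visits j k := by
        rw [hf.tsum_prod' ((summable_prod_of_nonneg hf0).1 hf).1]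
        simp_rw [htsum]
    _ = _ := (hinj.tsum_eq fun j hj => by
        by_contra h
        exact hj (hsupp j h)).symm

/-- The sum of the Green function over the segment of half-length `m` around the origin. -/
def segmentGreen (m : ℕ) : ℝ := ∑ k ∈ Finset.Icc (-m : ℤ) m, axisGreen k

theorem segmentGreen_eq_tsum (m : ℕ) :
    segmentGreen m =
      ∑' i, planeReturn i * ∑ k ∈ Finset.Icc (-m : ℤ) m, visits (2 * i) k := by
  simp only [segmentGreen, axisGreen_eq_tsum, Finset.mul_sum]
  exact (Summable.tsum_finsetSum fun k _ => summable_planeReturn_mul_visits k).symm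

theorem summable_segmentGreen (m : ℕ) :
    Summable fun i => planeReturn i * ∑ k ∈ Finset.Icc (-m : ℤ) m, visits (2 * i) k := by
  simp only [Finset.mul_sum]
  exact summable_sum fun k _ => summable_planeReturn_mul_visits k

theorem segmentGreen_nonneg (m : ℕ) : 0 ≤ segmentGreen m :=
  Finset.sum_nonneg fun k _ => axisGreen_nonneg k

/-- Cut at the diffusive scale `(m + 1) ^ 2`. Below it, the total vertical mass is at most 3/2.
Above it, each of the `2 m + 1` sites has a tail of order `1 / (m + 1)`. -/
theorem segmentGreen_le (m : ℕ) :
    segmentGreen m ≤ 3 / 2 * ∑ i ∈ Finset.range ((m + 1) ^ 2), planeReturn i + 32 := by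
  have hs := summable_segmentGreen m
  rw [segmentGreen_eq_tsum, ← hs.sum_add_tsum_nat_add ((m + 1) ^ 2)]
  refine add_le_add ?_ ?_
  · rw [Finset.mul_sum]
    refine Finset.sum_le_sum fun i _ => ?_
    rw [mul_comm (3 / 2 : ℝ)]
    exact mul_le_mul_of_nonneg_left (sum_visits_le _ _) (planeReturn_nonneg i)
  · refine Real.tsum_le_of_sum_range_le (fun i => mul_nonneg (planeReturn_nonneg _)
      (Finset.sum_nonneg fun k _ => visits_nonneg _ _)) fun n => ?_
    have hterm : ∀ i, planeReturn i * ∑ k ∈ Finset.Icc (-m : ℤ) m, visits (2 * i) k ≤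
        8 * (2 * m + 1) * (1 / (((i : ℝ) + 1) * √(i + 1))) := by
      intro i
      rw [Finset.mul_sum]
      refine (Finset.sum_le_card_nsmul _ _ _ fun k _ => planeReturn_mul_visits_le i k).trans_eq ?_
      rw [Int.card_Icc, nsmul_eq_mul, show ((m : ℤ) + 1 - -m).toNat = 2 * m + 1 by omega]
      push_cast
      ring
    refine (Finset.sum_le_sum fun i _ => hterm _).trans ?_
    rw [← Finset.mul_sum]
    have h := sum_one_div_mul_sqrt_le (M := (m + 1) ^ 2) (by positivity) n
    rw [show √(((m + 1) ^ 2 : ℕ) : ℝ) = m + 1 by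
      push_cast; exact Real.sqrt_sq (by positivity)] at h
    calc _ ≤ 8 * (2 * (m : ℝ) + 1) * (2 / (m + 1)) := by gcongr
      _ ≤ 32 := by
        rw [mul_div_assoc', div_le_iff₀ (by positivity)]
        linarith

/-- The Chebyshev loss grows like `2 i + 1`, while `planeReturn i ≤ 1 / (2 i + 1)`; so each of the
`(m + 1) ^ 2` terms loses at most `3 / 4 / (m + 1) ^ 2`. -/
theorem le_segmentGreen (m : ℕ) :
    3 / 2 * ∑ i ∈ Finset.range ((m + 1) ^ 2), planeReturn i - 3 / 4 ≤ segmentGreen m := by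
  rw [segmentGreen_eq_tsum]
  refine le_trans ?_ ((summable_segmentGreen m).sum_le_tsum (Finset.range ((m + 1) ^ 2))
    fun i _ => mul_nonneg (planeReturn_nonneg i) (Finset.sum_nonneg fun k _ => visits_nonneg _ _))
  have hm : (0 : ℝ) < (m + 1) ^ 2 := by positivity
  calc _ = ∑ i ∈ Finset.range ((m + 1) ^ 2),
          (3 / 2 * planeReturn i - 3 / 4 * (1 / (m + 1 : ℝ) ^ 2)) := by
        rw [Finset.sum_sub_distrib, ← Finset.mul_sum, Finset.sum_const, Finset.card_range,
          nsmul_eq_mul]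
        push_cast
        field_simp
    _ ≤ _ := by
        refine Finset.sum_le_sum fun i _ => ?_
        have h1 := mul_le_mul_of_nonneg_left (le_sum_visits m (2 * i)) (planeReturn_nonneg i)
        refine le_trans ?_ h1
        have h2 : planeReturn i * (2 * i + 1) ≤ 1 := by
          have := lineProb_two_mul_zero_sq_le i
          rwa [le_div_iff₀ (by positivity)] at this
        have h3 : planeReturn i * (3 / 2 - 3 / 4 * ((2 * i : ℕ) + 1) / (m + 1 : ℝ) ^ 2) =
            3 / 2 * planeReturn i -
              3 / 4 * ((planeReturn i * (2 * i + 1)) / (m + 1 : ℝ) ^ 2) := by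
          push_cast
          ring
        rw [h3]
        gcongr

end LongRods

end

/-! ### Logarithmic asymptotics of the segment sums and of their averages. -/

noncomputable section

namespace LongRods

open Filter Topology Asymptotics

/-- A Cesàro-type limit theorem for ratios of partial sums. -/
theorem tendsto_sum_div_sum {f g : ℕ → ℝ} {c : ℝ} (hg : ∀ i, 0 ≤ g i)
    (hg' : ∀ᶠ i in atTop, 0 < g i)
    (hsum : Tendsto (fun n => ∑ i ∈ Finset.range n, g i) atTop atTop)
    (h : Tendsto (fun i => f i / g i) atTop (𝓝 c)) :
    Tendsto (fun n => (∑ i ∈ Finset.range n, f i) / ∑ i ∈ Finset.range n, g i)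
      atTop (𝓝 c) := by
  have h1 : (fun i => f i - c * g i) =o[atTop] g := by
    rw [isLittleO_iff_tendsto' (hg'.mono fun i hi h0 => absurd h0 hi.ne')]
    have := h.sub_const c
    rw [sub_self] at this
    refine this.congr' (hg'.mono fun i hi => ?_)
    field_simp
  have h2 := (h1.sum_range hg hsum).tendsto_div_nhds_zero.add_const c
  rw [zero_add] at h2
  refine h2.congr' ((hsum.eventually_gt_atTop 0).mono fun n hn => ?_)
  rw [Finset.sum_sub_distrib, ← Finset.mul_sum]
  field_simp
  ring

theorem tendsto_log_natCast : Tendsto (fun n : ℕ => Real.log n) atTop atTop :=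
  Real.tendsto_log_atTop.comp tendsto_natCast_atTop_atTop

theorem tendsto_sum_one_div_div_log :
    Tendsto (fun n : ℕ => (∑ i ∈ Finset.range n, 1 / ((i : ℝ) + 1)) / Real.log n)
      atTop (𝓝 1) := by
  have h := (Real.tendsto_harmonic_sub_log.div_atTop tendsto_log_natCast).add_const 1
  rw [zero_add] at h
  refine h.congr' ((tendsto_log_natCast.eventually_gt_atTop 0).mono fun n hn => ?_)
  have : ((harmonic n : ℚ) : ℝ) = ∑ i ∈ Finset.range n, 1 / ((i : ℝ) + 1) := by
    simp [harmonic]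
  rw [this]
  field_simp
  ring

theorem tendsto_planeReturn_mul :
    Tendsto (fun i : ℕ => planeReturn i / (1 / ((i : ℝ) + 1))) atTop (𝓝 (1 / Real.pi)) := by
  have h1 : Tendsto (fun i : ℕ => ((i : ℝ) + 1) / (2 * i + 1)) atTop (𝓝 (1 / 2)) := by
    have h2 : Tendsto (fun i : ℕ => (1 : ℝ) / (2 * i + 1)) atTop (𝓝 0) := by
      refine squeeze_zero (fun i => by positivity) (fun i => ?_)
        (tendsto_one_div_add_atTop_nhds_zero_nat (𝕜 := ℝ))
      gcongr
      linarith [i.cast_nonneg (α := ℝ)]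
    have h3 := (h2.const_mul (1 / 2)).const_add (1 / 2)
    rw [mul_zero, add_zero] at h3
    refine h3.congr fun i => ?_
    field_simp
    ring
  have h2 := h1.div Real.Wallis.tendsto_W_nhds_pi_div_two (by positivity)
  rw [show (1 : ℝ) / 2 / (Real.pi / 2) = 1 / Real.pi by field_simp] at h2
  refine h2.congr fun i => ?_
  have h := lineProb_two_mul_zero_sq_mul_wallis i
  have hW := Real.Wallis.W_pos i
  rw [planeReturn]
  simp only [Pi.div_apply]
  rw [div_div, div_eq_iff (by positivity), div_div_eq_mul_div, div_one]
  linear_combination -((i : ℝ) + 1) * h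

theorem tendsto_sum_planeReturn_div_log :
    Tendsto (fun n : ℕ => (∑ i ∈ Finset.range n, planeReturn i) / Real.log n) atTop
      (𝓝 (1 / Real.pi)) := by
  have h := (tendsto_sum_div_sum (fun i => by positivity)
    (Eventually.of_forall fun i => by positivity)
    Real.tendsto_sum_range_one_div_nat_succ_atTop tendsto_planeReturn_mul).mul
    tendsto_sum_one_div_div_log
  rw [mul_one] at h
  refine h.congr' ((eventually_gt_atTop 0).mono fun n hn => ?_)
  have : 0 < ∑ i ∈ Finset.range n, 1 / ((i : ℝ) + 1) :=
    Finset.sum_pos (fun i _ => by positivity) (by simpa using hn.ne')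
  exact div_mul_div_cancel₀ this.ne'

theorem tendsto_segmentGreen_div_log :
    Tendsto (fun m : ℕ => segmentGreen m / Real.log ((m : ℝ) + 1)) atTop
      (𝓝 (3 / Real.pi)) := by
  have hlog : Tendsto (fun m : ℕ => Real.log ((m : ℝ) + 1)) atTop atTop := by
    have := (tendsto_add_atTop_iff_nat 1).2 tendsto_log_natCast
    exact_mod_cast this
  have hsq : Tendsto (fun m : ℕ => (m + 1) ^ 2) atTop atTop :=
    tendsto_atTop_mono (fun m => show m ≤ (m + 1) ^ 2 by nlinarith) tendsto_id
  have h : Tendsto (fun m : ℕ => (3 / 2 * ∑ i ∈ Finset.range ((m + 1) ^ 2), planeReturn i) /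
      Real.log ((m : ℝ) + 1)) atTop (𝓝 (3 / Real.pi)) := by
    -- The factor is `3 = 3/2 * 2`, the 2 coming from `log ((m + 1) ^ 2)`.
    have h0 := (tendsto_sum_planeReturn_div_log.comp hsq).const_mul 3
    rw [mul_one_div] at h0
    refine h0.congr fun m => ?_
    simp only [Function.comp_apply]
    push_cast
    rw [Real.log_pow]
    push_cast
    ring
  have hl := h.add ((tendsto_const_nhds (x := (-3 / 4 : ℝ))).div_atTop hlog)
  have hu := h.add ((tendsto_const_nhds (x := (32 : ℝ))).div_atTop hlog)
  rw [add_zero] at hl hu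
  refine tendsto_of_tendsto_of_tendsto_of_le_of_le' hl hu ?_ ?_
  · refine (hlog.eventually_gt_atTop 0).mono fun m hm => ?_
    rw [← add_div]
    gcongr
    linarith [le_segmentGreen m]
  · refine (hlog.eventually_gt_atTop 0).mono fun m hm => ?_
    rw [← add_div]
    gcongr
    exact segmentGreen_le m

theorem sum_log_eq (n : ℕ) :
    ∑ i ∈ Finset.range n, Real.log ((i : ℝ) + 1) = Real.log n.factorial := by
  induction n with
  | zero => simp
  | succ n ih =>
    rw [Finset.sum_range_succ, ih, Nat.factorial_succ]
    push_cast
    rw [Real.log_mul (by positivity) (by positivity), add_comm]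

theorem tendsto_log_factorial_div :
    Tendsto (fun n : ℕ => Real.log n.factorial / (n * Real.log n)) atTop (𝓝 1) := by
  have hl := ((tendsto_const_nhds (x := (1 : ℝ))).div_atTop tendsto_log_natCast).const_sub 1
  rw [sub_zero] at hl
  refine tendsto_of_tendsto_of_tendsto_of_le_of_le' hl tendsto_const_nhds ?_ ?_
  · filter_upwards [tendsto_log_natCast.eventually_gt_atTop 0, eventually_gt_atTop 0] with n hn h0
    have hn0 : (0 : ℝ) < n := by exact_mod_cast h0
    rw [le_div_iff₀ (by positivity)]
    have h := Real.log_le_log (by positivity) (Real.pow_div_factorial_le_exp n hn0.le n)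
    rw [Real.log_exp, Real.log_div (by positivity) (by positivity), Real.log_pow] at h
    have : (1 - 1 / Real.log n) * (n * Real.log n) = n * Real.log n - n := by field_simp
    linarith
  · filter_upwards [tendsto_log_natCast.eventually_gt_atTop 0, eventually_gt_atTop 0] with n hn h0
    have hn0 : (0 : ℝ) < n := by exact_mod_cast h0
    rw [div_le_one (by positivity), ← Real.log_pow]
    refine Real.log_le_log (by positivity) ?_
    exact_mod_cast Nat.factorial_le_pow n

/-- Cesàro with weights `log (m + 1)`, whose partial sums are `log n! ~ n log n`. The weight at `m =
0` vanishes, so positivity holds only eventually. -/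
theorem tendsto_sum_segmentGreen_div :
    Tendsto (fun n : ℕ => (∑ m ∈ Finset.range n, segmentGreen m) / (n * Real.log n)) atTop
      (𝓝 (3 / Real.pi)) := by
  have hmul : Tendsto (fun n : ℕ => (n : ℝ) * Real.log n) atTop atTop :=
    tendsto_natCast_atTop_atTop.atTop_mul_atTop₀ tendsto_log_natCast
  have hfac : Tendsto (fun n : ℕ => Real.log n.factorial) atTop atTop := by
    have := tendsto_log_factorial_div.pos_mul_atTop one_pos hmul
    refine this.congr' ?_
    filter_upwards [hmul.eventually_gt_atTop 0] with n hn
    exact div_mul_cancel₀ _ hn.ne'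
  have h := (tendsto_sum_div_sum (f := segmentGreen)
    (fun i => Real.log_nonneg (by linarith [i.cast_nonneg (α := ℝ)])) ?_ ?_
    tendsto_segmentGreen_div_log).mul tendsto_log_factorial_div
  · rw [mul_one] at h
    refine h.congr' ?_
    filter_upwards [hfac.eventually_gt_atTop 0] with n hn
    rw [sum_log_eq, div_mul_div_cancel₀ hn.ne']
  · filter_upwards [eventually_gt_atTop 0] with i hi
    have : (0 : ℝ) < i := by exact_mod_cast hi
    exact Real.log_pos (by linarith)
  · simp_rw [sum_log_eq]
    exact hfac

end LongRods

end

/-! ### The operator `G Ṽ_N` as a matrix on the rod. -/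

noncomputable section

namespace LongRods

open Filter Topology

theorem sum_axisGreen_le_segmentGreen {N : ℕ} {g : ℕ → ℤ} (hg : Function.Injective g)
    (hN : ∀ j ∈ Finset.range N, |g j| < N) :
    ∑ j ∈ Finset.range N, axisGreen (g j) ≤ segmentGreen (N - 1) := by
  rw [← Finset.sum_image (f := axisGreen) hg.injOn]
  refine Finset.sum_le_sum_of_subset_of_nonneg ?_ fun k _ _ => axisGreen_nonneg k
  intro k hk
  obtain ⟨j, hj, rfl⟩ := Finset.mem_image.1 hk
  have := abs_lt.1 (hN j hj)
  rw [Finset.mem_Icc]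
  omega

theorem segmentGreen_succ (m : ℕ) :
    segmentGreen (m + 1) = segmentGreen m + (axisGreen (m + 1) + axisGreen (-(m + 1))) := by
  have h : Finset.Icc (-((m + 1 : ℕ) : ℤ)) (m + 1 : ℕ) =
      insert ((m : ℤ) + 1) (insert (-((m : ℤ) + 1)) (Finset.Icc (-m : ℤ) m)) := by
    ext k
    simp only [Finset.mem_Icc, Finset.mem_insert]
    omega
  rw [segmentGreen, h, Finset.sum_insert, Finset.sum_insert, segmentGreen]
  · ring
  · simp
  · simp only [Finset.mem_Icc, Finset.mem_insert]
    omega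

theorem segmentGreen_eq_sum_range (m : ℕ) :
    segmentGreen m = axisGreen 0 + ∑ i ∈ Finset.range m, axisGreen (m - i) +
      ∑ i ∈ Finset.range m, axisGreen (i - m) := by
  have h : segmentGreen m =
      axisGreen 0 + ∑ i ∈ Finset.range m, (axisGreen (i + 1) + axisGreen (-(i + 1))) := by
    induction m with
    | zero => simp [segmentGreen]
    | succ m ih => rw [segmentGreen_succ, ih, Finset.sum_range_succ]; ring
  rw [h, add_assoc, ← Finset.sum_add_distrib, ← Finset.sum_range_reflect]
  congr 1
  refine Finset.sum_congr rfl fun i hi => ?_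
  have : ((m - 1 - i : ℕ) : ℤ) + 1 = m - i := by
    have := Finset.mem_range.1 hi
    omega
  rw [this, neg_sub]

/-- Enlarging the square by one adds a row, a column and a corner, where each offset from `-N` to
`N` occurs exactly once. -/
theorem sum_sum_axisGreen (N : ℕ) :
    ∑ i ∈ Finset.range N, ∑ j ∈ Finset.range N, axisGreen (j - i) =
      ∑ m ∈ Finset.range N, segmentGreen m := by
  induction N with
  | zero => simp
  | succ N ih =>
    simp only [Finset.sum_range_succ, Finset.sum_add_distrib]
    rw [ih, segmentGreen_eq_sum_range]
    simp
    ring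

/-- The values on the rod, numbered from `0`, of the iterates `(G Ṽ_N)^m 1`. -/
def rodIter (N : ℕ) : ℕ → ℕ → ℝ
  | 0, _ => 1
  | m + 1, i => ∑ j ∈ Finset.range N, axisGreen (j - i) / Real.log N * rodIter N m j

/-- The points of the rod `J_0`, numbered from `0`. -/
def rodSite (j : ℕ) : Site := ![0, 0, (j : ℤ) + 1]

theorem rodSite_injective : Function.Injective rodSite := fun a b h => by
  simpa [rodSite] using congrFun h 2

theorem rodPotential_rodSite {N j : ℕ} (hj : j < N) :
    rodPotential N (rodSite j) = 1 / Real.log N := by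
  refine Set.indicator_of_mem ?_ _
  simp [rod, rodSite]
  omega

theorem rodPotential_eq_zero {N : ℕ} {x : Site}
    (hx : x ∉ (Finset.range N).image rodSite) : rodPotential N x = 0 := by
  refine Set.indicator_of_notMem (fun h => hx ?_) _
  obtain ⟨h0, h1, h2, h3⟩ := h
  refine Finset.mem_image.2 ⟨(x 2 - 1).toNat, Finset.mem_range.2 (by omega), ?_⟩
  ext i
  fin_cases i
  · simpa [rodSite] using h0.symm
  · simpa [rodSite] using h1.symm
  · simp [rodSite]
    omega

theorem tsum_rodPotential_mul (N : ℕ) (f : Site → ℝ) :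
    ∑' x, rodPotential N x * f x =
      ∑ j ∈ Finset.range N, 1 / Real.log N * f (rodSite j) := by
  rw [tsum_eq_sum (s := (Finset.range N).image rodSite)
    fun x hx => by rw [rodPotential_eq_zero hx, zero_mul],
    Finset.sum_image rodSite_injective.injOn]
  exact Finset.sum_congr rfl fun j hj => by rw [rodPotential_rodSite (Finset.mem_range.1 hj)]

theorem green_rodSite (i j : ℕ) : green (rodSite i) (rodSite j) = axisGreen (j - i) := by
  have : rodSite j - rodSite i = ![0, 0, (j : ℤ) - i] := by
    ext k
    fin_cases k <;> simp [rodSite]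
  rw [green_eq_tsum, this, axisGreen]

theorem iterate_greenMul_rodSite (N m i : ℕ) :
    ((greenMul (rodPotential N))^[m] 1) (rodSite i) = rodIter N m i := by
  induction m generalizing i with
  | zero => rfl
  | succ m ih =>
    rw [Function.iterate_succ_apply', greenMul, greenOp, rodIter]
    have : ∀ x, green (rodSite i) x *
        (rodPotential N * (greenMul (rodPotential N))^[m] 1) x = rodPotential N x *
        (green (rodSite i) x * ((greenMul (rodPotential N))^[m] 1) x) := fun x => by
      rw [Pi.mul_apply]
      ring
    rw [tsum_congr this, tsum_rodPotential_mul N fun x =>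
      green (rodSite i) x * ((greenMul (rodPotential N))^[m] 1) x]
    refine Finset.sum_congr rfl fun j _ => ?_
    rw [ih, green_rodSite]
    ring

/-- The average over the rod of `(G Ṽ_N)^m 1`. -/
def rodMean (N m : ℕ) : ℝ := (∑ i ∈ Finset.range N, rodIter N m i) / N

theorem rodCoeff_eq (α : ℝ) {N : ℕ} (hN : 1 < N) (n : ℕ) :
    rodCoeff α N n = α * rodMean N (n - 1) := by
  have hlog : 0 < Real.log N := Real.log_pos (by exact_mod_cast hN)
  rw [rodCoeff, scalar, tsum_rodPotential_mul, rodMean, level, ← Finset.mul_sum]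
  simp_rw [iterate_greenMul_rodSite]
  field_simp

/-- A bound on the norm of `G Ṽ_N` on bounded functions on the rod. -/
def rodNorm (N : ℕ) : ℝ := segmentGreen (N - 1) / Real.log N

theorem rodNorm_nonneg (N : ℕ) : 0 ≤ rodNorm N :=
  div_nonneg (segmentGreen_nonneg _) (Real.log_natCast_nonneg N)

theorem sum_row_le {N i : ℕ} (hi : i < N) :
    ∑ j ∈ Finset.range N, axisGreen (j - i) / Real.log N ≤ rodNorm N := by
  rw [← Finset.sum_div]
  refine div_le_div_of_nonneg_right (sum_axisGreen_le_segmentGreen (fun a b h => ?_)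
    fun j hj => ?_) (Real.log_natCast_nonneg N)
  · simpa using h
  · have := Finset.mem_range.1 hj
    rw [abs_lt]
    omega

/-- Averaging an iterate over the rod sums the matrix over its row index, so column sums enter the
lower bound. -/
theorem sum_column_le {N j : ℕ} (hj : j < N) :
    ∑ i ∈ Finset.range N, axisGreen (j - i) / Real.log N ≤ rodNorm N := by
  rw [← Finset.sum_div]
  refine div_le_div_of_nonneg_right (sum_axisGreen_le_segmentGreen (fun a b h => ?_)
    fun i hi => ?_) (Real.log_natCast_nonneg N)
  · simpa using h
  · have := Finset.mem_range.1 hi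
    rw [abs_lt]
    omega

theorem rodIter_nonneg (N m i : ℕ) : 0 ≤ rodIter N m i := by
  induction m generalizing i with
  | zero => exact zero_le_one
  | succ m ih =>
    exact Finset.sum_nonneg fun j _ =>
      mul_nonneg (div_nonneg (axisGreen_nonneg _) (Real.log_natCast_nonneg N)) (ih j)

theorem rodIter_le {N i : ℕ} (hi : i < N) (m : ℕ) : rodIter N m i ≤ rodNorm N ^ m := by
  induction m generalizing i with
  | zero => exact le_of_eq rfl
  | succ m ih =>
    calc rodIter N (m + 1) i
        ≤ ∑ j ∈ Finset.range N, axisGreen (j - i) / Real.log N * rodNorm N ^ m :=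
          Finset.sum_le_sum fun j hj => mul_le_mul_of_nonneg_left (ih (Finset.mem_range.1 hj))
            (div_nonneg (axisGreen_nonneg _) (Real.log_natCast_nonneg N))
      _ ≤ rodNorm N * rodNorm N ^ m := by
          rw [← Finset.sum_mul]
          exact mul_le_mul_of_nonneg_right (sum_row_le hi) (pow_nonneg (rodNorm_nonneg N) m)
      _ = _ := (pow_succ' _ _).symm

theorem rodMean_nonneg (N m : ℕ) : 0 ≤ rodMean N m :=
  div_nonneg (Finset.sum_nonneg fun i _ => rodIter_nonneg N m i) N.cast_nonneg

theorem rodMean_le {N : ℕ} (hN : 0 < N) (m : ℕ) : rodMean N m ≤ rodNorm N ^ m := by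
  have hN' : (0 : ℝ) < N := by exact_mod_cast hN
  rw [rodMean, div_le_iff₀ hN', mul_comm]
  simpa using Finset.sum_le_card_nsmul (Finset.range N) _ _
    fun i hi => rodIter_le (Finset.mem_range.1 hi) m

/-- The average over the rod of `G Ṽ_N 1`. -/
def rodRowMean (N : ℕ) : ℝ := (∑ m ∈ Finset.range N, segmentGreen m) / (N * Real.log N)

/-- Replacing every column sum by its upper bound `rodNorm N` costs the nonnegative deficit times
the iterate. The iterate is at most `rodNorm N ^ m`, and the mean deficit is `rodNorm N - rodRowMean
N`. -/
theorem le_rodMean_succ {N : ℕ} (hN : 0 < N) (m : ℕ) :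
    rodNorm N * rodMean N m - rodNorm N ^ m * (rodNorm N - rodRowMean N) ≤ rodMean N (m + 1) := by
  have hN' : (0 : ℝ) < N := by exact_mod_cast hN
  set ρ := rodNorm N
  set col : ℕ → ℝ := fun j => ∑ i ∈ Finset.range N, axisGreen (j - i) / Real.log N
  have h1 : ∑ i ∈ Finset.range N, rodIter N (m + 1) i =
      ∑ j ∈ Finset.range N, col j * rodIter N m j := by
    simp only [rodIter, col, Finset.sum_mul]
    exact Finset.sum_comm
  have h2 : ∑ j ∈ Finset.range N, (ρ * rodIter N m j - ρ ^ m * (ρ - col j)) ≤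
      ∑ j ∈ Finset.range N, col j * rodIter N m j := by
    refine Finset.sum_le_sum fun j hj => ?_
    have hj' := Finset.mem_range.1 hj
    have := mul_le_mul_of_nonneg_right (rodIter_le hj' m) (sub_nonneg.2 (sum_column_le hj'))
    simp only [col]
    linarith
  have h3 : ∑ j ∈ Finset.range N, col j = rodRowMean N * N := by
    simp only [col, ← Finset.sum_div]
    rw [Finset.sum_comm, sum_sum_axisGreen, rodRowMean]
    field_simp
  rw [Finset.sum_sub_distrib, ← Finset.mul_sum, ← Finset.mul_sum, Finset.sum_sub_distrib, h3,
    ← h1, Finset.sum_const, Finset.card_range, nsmul_eq_mul] at h2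
  rw [rodMean, rodMean, le_div_iff₀ hN']
  refine le_trans (le_of_eq ?_) h2
  field_simp

theorem tendsto_rodNorm : Tendsto rodNorm atTop (𝓝 (3 / Real.pi)) := by
  rw [← tendsto_add_atTop_iff_nat 1]
  refine tendsto_segmentGreen_div_log.congr fun m => ?_
  simp [rodNorm]

theorem tendsto_rodMean (m : ℕ) :
    Tendsto (fun N => rodMean N m) atTop (𝓝 ((3 / Real.pi) ^ m)) := by
  induction m with
  | zero =>
    refine tendsto_const_nhds.congr' ((eventually_gt_atTop 0).mono fun N hN => ?_)
    have hN' : (N : ℝ) ≠ 0 := by exact_mod_cast hN.ne'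
    simp [rodMean, rodIter, hN']
  | succ m ih =>
    have hl := (tendsto_rodNorm.mul ih).sub
      ((tendsto_rodNorm.pow m).mul (tendsto_rodNorm.sub tendsto_sum_segmentGreen_div))
    rw [sub_self, mul_zero, sub_zero, ← pow_succ'] at hl
    exact tendsto_of_tendsto_of_tendsto_of_le_of_le' hl (tendsto_rodNorm.pow (m + 1))
      ((eventually_gt_atTop 0).mono fun N hN => le_rodMean_succ hN m)
      ((eventually_gt_atTop 0).mono fun N hN => rodMean_le hN (m + 1))

end LongRods

end

theorem theorem4p8 :
    (∃ c₇ : ℝ, 0 < c₇ ∧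
      ∀ α : ℝ, 0 < α → ∀ n : ℕ, 1 ≤ n → ∀ N : ℕ, 1 < N →
        0 ≤ LongRods.rodCoeff α N n ∧ LongRods.rodCoeff α N n ≤ α * c₇ ^ n) ∧
    (∀ α : ℝ, 0 < α → ∀ n : ℕ, 1 ≤ n →
      Filter.Tendsto (fun N : ℕ => LongRods.rodCoeff α N n) Filter.atTop
        (nhds (α * (3 / Real.pi) ^ (n - 1)))) := by
  constructor
  · obtain ⟨C, hC⟩ := LongRods.tendsto_rodNorm.bddAbove_range
    -- A constant at least 1 allows the exponent `n - 1` to be raised to `n`.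
    refine ⟨max C 1, by positivity, fun α hα n hn N hN => ?_⟩
    rw [LongRods.rodCoeff_eq α hN n]
    refine ⟨mul_nonneg hα.le (LongRods.rodMean_nonneg N _), ?_⟩
    refine mul_le_mul_of_nonneg_left ?_ hα.le
    calc LongRods.rodMean N (n - 1) ≤ LongRods.rodNorm N ^ (n - 1) :=
          LongRods.rodMean_le (by omega) _
      _ ≤ max C 1 ^ (n - 1) :=
          pow_le_pow_left₀ (LongRods.rodNorm_nonneg N)
            ((hC (Set.mem_range_self N)).trans (le_max_left _ _)) _
      _ ≤ max C 1 ^ n := pow_le_pow_right₀ (le_max_right _ _) (Nat.sub_le n 1)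
  · intro α _ n _
    refine ((LongRods.tendsto_rodMean (n - 1)).const_mul α).congr' ?_
    filter_upwards [Filter.eventually_gt_atTop 1] with N hN
    exact (LongRods.rodCoeff_eq α hN n).symm
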